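/- **Conventions.** MV-algebras are algebras $\langle A,\wedge,\vee,\odot,\to,0,1\rangle$, and $[0,1]_{MV}$ is the real unit interval with $x\odot y=\max(0,x+y-1)$, $x\to y=\min(1,1-x+y)$ and the usual lattice operations; $Q_{[0,1]}$ is its subalgebra of rational numbers. Let $\sigma$ be a family of new finitary operation symbols, let $E(\sigma)$ be a set of equations in the language of MV-algebras expanded by $\sigma$, and let $\mathcal{MV}_{E(\sigma)}$ be the variety of all MV-algebras with additional operations $\sigma$ that satisfy $E(\sigma)$. An $E(\sigma)$-expansion of an MV-algebra $A$ is a family of operations $\sigma_A$ on $A$ with $(A,\sigma_A)\in\mathcal{MV}_{E(\sigma)}$. The variety $\mathcal{MV}_{E(\sigma)}$ is *admissible* if 1. (compatibility) for every $A\in\mathcal{MV}_{E(\sigma)}$, the congruences of $A$ are exactly the congruences of its MV-reduct; 2. (canonical expansion) $[0,1]_{MV}$ has exactly one $E(\sigma)$-expansion, written $[0,1]_{E(\sigma)}$, and every MV-subalgebra of $[0,1]_{MV}$ has at most one; 3. $Q_{[0,1]}$ has an $E(\sigma)$-expansion (unique by 2). Łukasiewicz logic Ł has the primitive connectives $\to,0$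 (with $\neg\alpha:=\alpha\to 0$), the axiom schemes $\alpha\to(\beta\to\alpha)$, $(\alpha\to\beta)\to((\beta\to\gamma)\to(\alpha\to\gamma))$, $(\neg\alpha\to\neg\beta)\to(\beta\to\alpha)$, $((\alpha\to\beta)\to\beta)\to((\beta\to\alpha)\to\alpha)$, and modus ponens as its only rule. Let $\text{Ł}_\sigma$ be an *admissible expansion* of Ł: a logic obtained from Ł by adding the connectives $\sigma$ and some set of new axiom schemes (and no new rule), which is algebraizable in an admissible variety $\mathcal{MV}_{E(\sigma)}$. That is, there are a finite set $p\Leftrightarrow q$ of binary formulas and a finite set $\delta(p)\approx\epsilon(p)$ of equations in one variable such that, with $\models$ the equational consequence relation of $\mathcal{MV}_{E(\sigma)}$, for all formulas * $\varphi_1,\dots,\varphi_n\vdash\varphi$ if and only if $\{\delta(\varphi_i)\approx\epsilon(\varphi_i)\}_{i=1}^n\models\delta(\varphi)\approx\epsilon(\varphi)$; * $\varphi\approx\psi$ and $\delta(\varphi\Leftrightarrow\psi)\approx\epsilon(\varphi\Leftrightarrow\psi)$ are consequences of each other under $\models$. The *$\sigma$-Pavelka expansion* is obtained from $\text{Ł}_\sigma$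 by adding to the language (in which the axiom schemes are now instantiated) a truth constant $\overline r$ for each $r\in\mathbb{Q}\cap[0,1]$ and, as axioms, both implications of each of $$\overline 0\Longleftrightarrow 0,\qquad (\overline r\to\overline s)\Longleftrightarrow\overline{r\to s},\qquad f(\overline{r_1},\dots,\overline{r_n})\Longleftrightarrow\overline{f(r_1,\dots,r_n)}$$ for all $r,s,r_i\in\mathbb{Q}\cap[0,1]$ and all $n$-ary $f\in\sigma$, where on the right $\to$ and $f$ are computed in the $E(\sigma)$-expansion of $Q_{[0,1]}$. A *theory* is a set $T$ of formulas, in countably many propositional variables, that is closed under derivability in the $\sigma$-Pavelka expansion. A valuation is a homomorphism $v$ from the algebra of formulas to $[0,1]_{E(\sigma)}$, with $v(\overline r)=r$ for every $r$. For a theory $T$ and a formula $\varphi$ put, with suprema and infima taken in $[0,1]$ (so $\inf\emptyset=1$), $$|\varphi|_T=\sup\{r\in\mathbb{Q}\cap[0,1] : (\overline r\to\varphi)\in T\},\qquad \|\varphi\|_T=\inf\{v(\varphi) : v\text{ a valuation with } v(\psi)=1\text{ for all }\psi\in T\}.$$ **Theorem.** Let $\text{Ł}_\sigma$ be an admissible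 expansion of Łukasiewicz logic. Then for every theory $T$ and every formula $\varphi$ of the $\sigma$-Pavelka expansion of $\text{Ł}_\sigma$, $$|\varphi|_T=\|\varphi\|_T .$$ -/

import Mathlib

universe u v w

namespace Pavelka

/-! ### Signatures, terms and interpretations -/

/-- A family `σ` of new finitary operation symbols (connectives), with their arities. -/
structure Signature where
  Op : Type u
  ar : Op → ℕ

/-- Terms over the vocabulary `{→, 0} ∪ σ` with variables in `X`. -/
inductive Tm (σ : Signature.{u}) (X : Type v) : Type (max u v)
  | var (x : X) : Tm σ X
  | zero : Tm σ X
  | imp (s t : Tm σ X) : Tm σ X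
  | op (f : σ.Op) (args : Fin (σ.ar f) → Tm σ X) : Tm σ X

/-- Formulas: terms over the propositional variables `p₀, p₁, p₂, …`. -/
abbrev Fm (σ : Signature.{u}) : Type u := Tm σ ℕ

/-- Simultaneous substitution. -/
def Tm.subst {σ : Signature.{u}} {X : Type v} {Y : Type w} (s : X → Tm σ Y) :
    Tm σ X → Tm σ Y
  | .var x => s x
  | .zero => .zero
  | .imp a b => .imp (a.subst s) (b.subst s)
  | .op f args => .op f fun i => (args i).subst s

/-- Negation `¬ a`, that is `a → 0`. -/
def Tm.neg {σ : Signature.{u}} {X : Type v} (a : Tm σ X) : Tm σ X := .imp a .zero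

/-- The primitive MV-operations `→` and `0`; the others are the usual terms in these two. -/
class MVOps (A : Type v) where
  imp : A → A → A
  zero : A

namespace MVOps

variable {A : Type v} [MVOps A]

def neg (x : A) : A := imp x zero
def one : A := neg (zero : A)
def odot (x y : A) : A := neg (imp x (neg y))
def meet (x y : A) : A := odot x (imp x y)
def join (x y : A) : A := imp (imp x y) y

end MVOps

open MVOps in
/-- MV-algebras, in the vocabulary `{→, 0}`: `⊙` and `1` form an abelian monoid, `∨, ∧, 0, 1`
form a bounded lattice, and `→` satisfies the remaining identities. -/
structure IsMV (A : Type v) [MVOps A] : Prop where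
  odot_assoc : ∀ x y z : A, odot (odot x y) z = odot x (odot y z)
  odot_comm : ∀ x y : A, odot x y = odot y x
  odot_one : ∀ x : A, odot x one = x
  meet_assoc : ∀ x y z : A, meet (meet x y) z = meet x (meet y z)
  meet_comm : ∀ x y : A, meet x y = meet y x
  join_assoc : ∀ x y z : A, join (join x y) z = join x (join y z)
  join_comm : ∀ x y : A, join x y = join y x
  meet_join : ∀ x y : A, meet x (join x y) = x
  join_meet : ∀ x y : A, join x (meet x y) = x
  join_zero : ∀ x : A, join x zero = x
  meet_one : ∀ x : A, meet x one = x
  residuation : ∀ x y z : A, imp (odot x y) z = imp x (imp y z)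
  counit : ∀ x y : A, meet (odot (imp x y) x) y = odot (imp x y) x
  meet_imp : ∀ x y : A, imp (meet x y) y = one
  divisibility : ∀ x y : A, odot x (imp x y) = meet x y
  prelinearity : ∀ x y : A, join (imp x y) (imp y x) = one
  involution : ∀ x : A, imp (imp x zero) zero = x

/-- A family of operations on `A` interpreting the symbols of `σ`. -/
abbrev Interp (σ : Signature.{u}) (A : Type v) : Type (max u v) :=
  ∀ f : σ.Op, (Fin (σ.ar f) → A) → A

/-- The homomorphic extension to terms of an assignment of elements of `A` to variables. Since
the term algebra is absolutely free, these are exactly the homomorphisms from it to `A`. -/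
def Tm.eval {σ : Signature.{u}} {X : Type v} {A : Type w} [MVOps A] (I : Interp σ A)
    (e : X → A) : Tm σ X → A
  | .var x => e x
  | .zero => MVOps.zero
  | .imp a b => MVOps.imp (a.eval I e) (b.eval I e)
  | .op f args => I f fun i => (args i).eval I e

/-! ### Expansions of the variety of MV-algebras -/

/-- The algebra `(A, I)` lies in the variety of expanded MV-algebras given by the set `E` of
equations: it is an MV-algebra and satisfies every equation of `E`. -/
structure InVariety {σ : Signature.{u}} (E : Set (Fm σ × Fm σ)) {A : Type v} [MVOps A]
    (I : Interp σ A) : Prop where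
  isMV : IsMV A
  sat : ∀ eq ∈ E, ∀ e : ℕ → A, eq.1.eval I e = eq.2.eval I e

/-- Congruences of the MV-reduct. -/
def IsMVCongruence {A : Type v} [MVOps A] (r : Setoid A) : Prop :=
  ∀ x x' y y' : A, r x x' → r y y' → r (MVOps.imp x y) (MVOps.imp x' y')

/-- Congruences of the expanded algebra. -/
def IsCongruence {σ : Signature.{u}} {A : Type v} [MVOps A] (I : Interp σ A) (r : Setoid A) :
    Prop :=
  IsMVCongruence r ∧
    ∀ (f : σ.Op) (x y : Fin (σ.ar f) → A), (∀ i, r (x i) (y i)) → r (I f x) (I f y)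

/-- The expansion is compatible: its algebras have the same congruences as their MV-reducts. -/
def IsCompatible {σ : Signature.{u}} (E : Set (Fm σ × Fm σ)) : Prop :=
  ∀ (A : Type u) [MVOps A] (I : Interp σ A), InVariety E I →
    {r : Setoid A | IsCongruence I r} = {r : Setoid A | IsMVCongruence r}

/-- Subalgebras with respect to the MV-operations. -/
structure MVSub (A : Type v) [MVOps A] where
  carrier : Set A
  zero_mem : MVOps.zero ∈ carrier
  imp_mem : ∀ x ∈ carrier, ∀ y ∈ carrier, MVOps.imp x y ∈ carrier

instance {A : Type v} [MVOps A] (B : MVSub A) : MVOps B.carrier where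
  imp x y := ⟨MVOps.imp x.1 y.1, B.imp_mem _ x.2 _ y.2⟩
  zero := ⟨MVOps.zero, B.zero_mem⟩

/-- `A` admits a canonical expansion: it has exactly one expansion in the variety, and each
of its MV-subalgebras has at most one. -/
def AdmitsCanonical {σ : Signature.{u}} (E : Set (Fm σ × Fm σ)) (A : Type v) [MVOps A] : Prop :=
  (∃! I : Interp σ A, InVariety E I) ∧
    ∀ (B : MVSub A) (I₁ I₂ : Interp σ B.carrier), InVariety E I₁ → InVariety E I₂ → I₁ = I₂

/-- The standard MV-algebra on the real unit interval: `x → y = min 1 (1 - x + y)`. -/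
instance : MVOps unitInterval where
  imp x y := ⟨min 1 (1 - (x : ℝ) + y),
    le_min zero_le_one (by linarith [x.2.2, y.2.1]), min_le_left _ _⟩
  zero := 0

/-- The subalgebra of the rational numbers in the real unit interval. -/
def ratSub : MVSub unitInterval where
  carrier := {x | ∃ q : ℚ, (q : ℝ) = x}
  zero_mem := ⟨0, by simp [MVOps.zero]⟩
  imp_mem := by
    rintro x ⟨p, hp⟩ y ⟨q, hq⟩
    exact ⟨min 1 (1 - p + q), by simp [MVOps.imp, hp, hq]⟩

/-- The rational numbers of the unit interval, with the MV-operations of `[0,1]`. -/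
abbrev RatI : Type := ratSub.carrier

/-- Admissible expansions of the variety of MV-algebras. -/
structure IsAdmissibleVariety {σ : Signature.{u}} (E : Set (Fm σ × Fm σ)) : Prop where
  compatible : IsCompatible E
  canonical : AdmitsCanonical E unitInterval
  rational : ∃ J : Interp σ RatI, InVariety E J

/-! ### Logics -/

/-- Derivability from the hypotheses `Γ` in the axiomatic expansion of Łukasiewicz logic by the
axiom schemes `Ax` (all substitution instances of the members of `Ax` are axioms); modus ponens is
the only rule. -/
inductive Derivable {σ : Signature.{u}} (Ax Γ : Set (Fm σ)) : Fm σ → Prop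
  | hyp {a : Fm σ} (h : a ∈ Γ) : Derivable Ax Γ a
  | luk1 (a b : Fm σ) : Derivable Ax Γ (.imp a (.imp b a))
  | luk2 (a b c : Fm σ) :
      Derivable Ax Γ (.imp (.imp a b) (.imp (.imp b c) (.imp a c)))
  | luk3 (a b : Fm σ) : Derivable Ax Γ (.imp (.imp a.neg b.neg) (.imp b a))
  | luk4 (a b : Fm σ) :
      Derivable Ax Γ (.imp (.imp (.imp a b) b) (.imp (.imp b a) a))
  | ax {a : Fm σ} (h : a ∈ Ax) (s : ℕ → Fm σ) : Derivable Ax Γ (a.subst s)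
  | mp {a b : Fm σ} (h₁ : Derivable Ax Γ a) (h₂ : Derivable Ax Γ (.imp a b)) :
      Derivable Ax Γ b

/-- Theories: sets of formulas closed under derivability. -/
def IsTheory {σ : Signature.{u}} (Ax T : Set (Fm σ)) : Prop :=
  ∀ a : Fm σ, Derivable Ax T a → a ∈ T

/-- The equational consequence relation of the variety given by `E`. -/
def EqConseq {σ : Signature.{u}} (E Θ : Set (Fm σ × Fm σ)) (eq : Fm σ × Fm σ) : Prop :=
  ∀ (A : Type u) [MVOps A] (I : Interp σ A), InVariety E I → ∀ e : ℕ → A,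
    (∀ th ∈ Θ, th.1.eval I e = th.2.eval I e) → eq.1.eval I e = eq.2.eval I e

/-- The equations `δ(a) ≈ ε(a)`, for `a` in `Γ` and `δ ≈ ε` in `D`. -/
def defEqs {σ : Signature.{u}} (D : Finset (Tm σ (Fin 1) × Tm σ (Fin 1))) (Γ : Set (Fm σ)) :
    Set (Fm σ × Fm σ) :=
  {eq | ∃ a ∈ Γ, ∃ d ∈ D, eq = (d.1.subst ![a], d.2.subst ![a])}

/-- The set of formulas `a ⇔ b` for a finite system `Eqv` of binary formulas. -/
def eqvFms {σ : Signature.{u}} (Eqv : Finset (Tm σ (Fin 2))) (a b : Fm σ) : Set (Fm σ) :=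
  {c | ∃ t ∈ Eqv, c = t.subst ![a, b]}

/-- The logic with axiom schemes `Ax` is algebraizable in the variety given by `E`, via some
finite system `Eqv` of equivalence formulas and some finite system `D` of defining equations. -/
def IsAlgebraizable {σ : Signature.{u}} (Ax : Set (Fm σ)) (E : Set (Fm σ × Fm σ)) : Prop :=
  ∃ (Eqv : Finset (Tm σ (Fin 2))) (D : Finset (Tm σ (Fin 1) × Tm σ (Fin 1))),
    (∀ (Γ : Set (Fm σ)), Γ.Finite → ∀ a : Fm σ,
      Derivable Ax Γ a ↔ ∀ eq ∈ defEqs D {a}, EqConseq E (defEqs D Γ) eq) ∧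
    (∀ a b : Fm σ,
      (∀ eq ∈ defEqs D (eqvFms Eqv a b), EqConseq E {(a, b)} eq) ∧
        EqConseq E (defEqs D (eqvFms Eqv a b)) (a, b))

/-- The logic with new connectives `σ` and new axiom schemes `Ax` is an admissible expansion of
Łukasiewicz logic, algebraizable in the admissible expansion of MV-algebras given by `E`. -/
structure IsAdmissibleExpansion {σ : Signature.{u}} (Ax : Set (Fm σ)) (E : Set (Fm σ × Fm σ)) :
    Prop where
  admissible : IsAdmissibleVariety E
  algebraizable : IsAlgebraizable Ax E

/-! ### Pavelka expansions -/

/-- The signature `σ` with an additional constant for each rational number in `[0,1]`. -/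
def Signature.pavelka (σ : Signature.{u}) : Signature.{u} where
  Op := σ.Op ⊕ RatI
  ar := Sum.elim σ.ar fun _ => 0

/-- The truth constant of a rational number in `[0,1]`. -/
def truthConst {σ : Signature.{u}} (r : RatI) : Fm σ.pavelka :=
  .op (σ := σ.pavelka) (Sum.inr r) Fin.elim0

/-- Terms over `σ` as terms over the signature with truth constants. -/
def Tm.toPavelka {σ : Signature.{u}} {X : Type v} : Tm σ X → Tm σ.pavelka X
  | .var x => .var x
  | .zero => .zero
  | .imp a b => .imp a.toPavelka b.toPavelka
  | .op f args => .op (σ := σ.pavelka) (Sum.inl f) fun i => (args i).toPavelka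

/-- The two implications that make up `a ⟺ b`. -/
def biimp {σ : Signature.{u}} (a b : Fm σ) : Set (Fm σ) := {.imp a b, .imp b a}

/-- The book-keeping axioms, where `J` is the family of `σ`-operations on the rationals. -/
def bookkeeping {σ : Signature.{u}} (J : Interp σ RatI) : Set (Fm σ.pavelka) :=
  biimp (truthConst MVOps.zero) .zero ∪
  (⋃ (r : RatI) (s : RatI),
    biimp (.imp (truthConst r) (truthConst s)) (truthConst (MVOps.imp r s))) ∪
  ⋃ (f : σ.Op) (r : Fin (σ.ar f) → RatI),
    biimp (.op (σ := σ.pavelka) (Sum.inl f) fun i => truthConst (r i)) (truthConst (J f r))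

/-- The axiom schemes of the Pavelka expansion of the logic with axiom schemes `Ax`. -/
def pavelkaAx {σ : Signature.{u}} (Ax : Set (Fm σ)) (J : Interp σ RatI) : Set (Fm σ.pavelka) :=
  Tm.toPavelka '' Ax ∪ bookkeeping J

/-- Operations on `[0,1]` extended by interpreting each truth constant as its own value. -/
def Interp.pavelka {σ : Signature.{u}} (I : Interp σ unitInterval) :
    Interp σ.pavelka unitInterval
  | .inl f => I f
  | .inr r => fun _ => r.1

/-- The proof degree of `a` over `T`. -/
noncomputable def proofDegree {σ : Signature.{u}} (T : Set (Fm σ.pavelka)) (a : Fm σ.pavelka) :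
    unitInterval :=
  sSup {x | ∃ r : RatI, x = r.1 ∧ .imp (truthConst r) a ∈ T}

/-- The truth degree of `a` over `T`: the infimum in `[0,1]` (so the infimum of the empty set
is `1`) of the values of `a` under the valuations that give every member of `T` the value `1`. -/
noncomputable def truthDegree {σ : Signature.{u}} (I : Interp σ unitInterval)
    (T : Set (Fm σ.pavelka)) (a : Fm σ.pavelka) : unitInterval :=
  sInf {x | ∃ e : ℕ → unitInterval,
    (∀ b ∈ T, b.eval I.pavelka e = 1) ∧ x = a.eval I.pavelka e}

end Pavelka

open Pavelka

/-!
Soundness gives `|φ|_T ≤ ‖φ‖_T`. For the converse, a rational `r` with `r → φ` outside `T` must be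
shown to admit a model of `T` in `[0,1]` in which `φ` has value at most `r`.

By prelinearity and a maximality argument, `T` extends to a prime theory `F` that omits `r → φ`
(`IsImpFilter.exists_prime`). Modulo `F` every formula is comparable with the truth constants, and
`g a = sup {s | (s → a) ∈ F}` preserves `→`, `0` and the constants, by a squeezing argument
(`IsPrimePavelkaFilter.value_imp`); moreover `φ → r` is in `F`, whence `g φ ≤ r`. It remains to see
that `g` is a valuation, that is, that it commutes with the connectives of `σ` as computed in
`[0,1]`.

Compatibility forces the defining equations of the algebraization to mean `x ≈ 1`
(`defSet_eq_singleton`), so the Lindenbaum algebra of `F` lies in the variety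
(`Lindenbaum.inVariety`). The kernel of `g` is a congruence of its MV-reduct, hence of the expanded
algebra, and so the range `B` of `g`, an MV-subalgebra of `[0,1]`, inherits operations that put it
in the variety. A second use of compatibility, in the algebra `B^ℕ` with the congruence
`dist (xₙ) (yₙ) → 0`, shows that these operations preserve convergence of sequences
(`IsCompatible.tendsto_dist`). As `B` contains the rationals, they extend by continuity to `[0,1]`,
where the equations persist, and the extension is the canonical one by uniqueness
(`IsAdmissibleVariety.coe_interp_eq`).
-/

namespace Pavelka

/-! ### Implicative filters -/

/-- Sets containing all values of the purely implicational Łukasiewicz axioms and closed under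
modus ponens. Both the theories of the logic and the filters of an MV-algebra are of this kind. -/
structure IsImpFilter {A : Type v} [MVOps A] (F : Set A) : Prop where
  weakening : ∀ a b : A, MVOps.imp a (MVOps.imp b a) ∈ F
  suffixing : ∀ a b c : A,
    MVOps.imp (MVOps.imp a b) (MVOps.imp (MVOps.imp b c) (MVOps.imp a c)) ∈ F
  join_swap : ∀ a b : A,
    MVOps.imp (MVOps.imp (MVOps.imp a b) b) (MVOps.imp (MVOps.imp b a) a) ∈ F
  mp : ∀ {a b : A}, a ∈ F → MVOps.imp a b ∈ F → b ∈ F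

namespace IsImpFilter

open MVOps

variable {A : Type v} [MVOps A] {F : Set A}

theorem trans (hF : IsImpFilter F) {a b c : A} (h₁ : imp a b ∈ F) (h₂ : imp b c ∈ F) :
    imp a c ∈ F :=
  hF.mp h₂ (hF.mp h₁ (hF.suffixing a b c))

theorem imp_of_mem (hF : IsImpFilter F) {b : A} (a : A) (h : b ∈ F) : imp a b ∈ F :=
  hF.mp h (hF.weakening b a)

theorem assertion (hF : IsImpFilter F) (a b : A) : imp a (imp (imp a b) b) ∈ F :=
  hF.trans (hF.weakening a (imp b a)) (hF.join_swap b a)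

theorem exchange (hF : IsImpFilter F) (a b c : A) :
    imp (imp a (imp b c)) (imp b (imp a c)) ∈ F :=
  hF.trans (hF.suffixing a (imp b c) c)
    (hF.mp (hF.assertion b c) (hF.suffixing b (imp (imp b c) c) (imp a c)))

theorem refl (hF : IsImpFilter F) (a : A) : imp a a ∈ F :=
  hF.mp (hF.weakening a a) (hF.mp (hF.weakening a (imp a (imp a a))) (hF.exchange _ _ _))

theorem imp_mono_right (hF : IsImpFilter F) {b c : A} (a : A) (h : imp b c ∈ F) :
    imp (imp a b) (imp a c) ∈ F :=
  hF.mp h (hF.mp (hF.suffixing a b c) (hF.exchange _ _ _))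

theorem imp_mono (hF : IsImpFilter F) {a a' b b' : A} (ha : imp a' a ∈ F) (hb : imp b b' ∈ F) :
    imp (imp a b) (imp a' b') ∈ F :=
  hF.trans (hF.mp ha (hF.suffixing a' a b)) (hF.imp_mono_right a' hb)

/-- Proof by cases on a join `p ∨ q = (p → q) → q` belonging to the filter. -/
theorem join_elim (hF : IsImpFilter F) {p q z : A} (hp : imp p z ∈ F) (hq : imp q z ∈ F)
    (hpq : imp (imp p q) q ∈ F) : z ∈ F :=
  -- `p ∨ q ≤ z ∨ q = q ∨ z`, and `q ∨ z = (q → z) → z` yields `z`.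
  hF.mp hq (hF.mp (hF.mp hpq (hF.imp_mono (hF.imp_mono hp (hF.refl q)) (hF.refl q)))
    (hF.join_swap z q))

/-- The congruence `a ↔ b ∈ F` of an implicative filter `F`. -/
def setoid (hF : IsImpFilter F) : Setoid A where
  r a b := imp a b ∈ F ∧ imp b a ∈ F
  iseqv :=
    ⟨fun a => ⟨hF.refl a, hF.refl a⟩, fun h => ⟨h.2, h.1⟩,
      fun h k => ⟨hF.trans h.1 k.1, hF.trans k.2 h.2⟩⟩

theorem isMVCongruence_setoid (hF : IsImpFilter F) : IsMVCongruence hF.setoid :=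
  fun _ _ _ _ hx hy => ⟨hF.imp_mono hx.2 hy.1, hF.imp_mono hx.1 hy.2⟩

theorem iterate_mono (hF : IsImpFilter F) (a : A) {x y : A} (h : imp x y ∈ F) (n : ℕ) :
    imp ((imp a)^[n] x) ((imp a)^[n] y) ∈ F := by
  induction n with
  | zero => exact h
  | succ n ih =>
    rw [Function.iterate_succ_apply', Function.iterate_succ_apply']
    exact hF.imp_mono_right a ih

theorem iterate_exchange (hF : IsImpFilter F) (a x y : A) (n : ℕ) :
    imp ((imp a)^[n] (imp x y)) (imp x ((imp a)^[n] y)) ∈ F := by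
  induction n with
  | zero => exact hF.refl _
  | succ n ih =>
    rw [Function.iterate_succ_apply', Function.iterate_succ_apply']
    exact hF.trans (hF.imp_mono_right a ih) (hF.exchange _ _ _)

theorem imp_iterate (hF : IsImpFilter F) (a x : A) (n : ℕ) : imp x ((imp a)^[n] x) ∈ F := by
  induction n with
  | zero => exact hF.refl _
  | succ n ih =>
    rw [Function.iterate_succ_apply']
    exact hF.trans ih (hF.weakening _ _)

/-- The filter generated by `F` and `a`, in the form of the local deduction theorem: it consists
of the `x` such that `a → (a → ⋯ → (a → x))` lies in `F` for some number of premises `a`. -/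
theorem adjoin (hF : IsImpFilter F) (a : A) : IsImpFilter {x | ∃ n, (imp a)^[n] x ∈ F} where
  weakening x y := ⟨0, hF.weakening x y⟩
  suffixing x y z := ⟨0, hF.suffixing x y z⟩
  join_swap x y := ⟨0, hF.join_swap x y⟩
  mp := by
    rintro x y ⟨n, hn⟩ ⟨m, hm⟩
    refine ⟨n + m, ?_⟩
    rw [Function.iterate_add_apply]
    exact hF.mp hn (hF.iterate_mono a (hF.mp hm (hF.iterate_exchange a x y m)) n)

/-- Proof by cases with iterated premises: the sequents `pⁿ → z` and `qᵐ → z` give `z` whenever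
`p ∨ q` lies in the filter. -/
theorem join_elim_iterate (hF : IsImpFilter F) {p q z : A} (hpq : imp (imp p q) q ∈ F) {n m : ℕ}
    (hp : (imp p)^[n] z ∈ F) (hq : (imp q)^[m] z ∈ F) : z ∈ F := by
  have single : ∀ (n : ℕ) (w : A), (imp p)^[n] w ∈ F → imp q w ∈ F → w ∈ F := by
    intro n
    induction n with
    | zero => exact fun w h _ => h
    | succ n ih =>
      intro w h k
      rw [Function.iterate_succ_apply'] at h
      exact ih w (hF.join_elim h (hF.trans k (hF.imp_iterate p w n)) hpq) k
  induction m with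
  | zero => exact hq
  | succ m ih =>
    rw [Function.iterate_succ_apply'] at hq
    exact ih (single n _ (hF.mp hp (hF.iterate_mono p (hF.imp_iterate q z m) n)) hq)

/-- A filter maximal among those omitting `c` is prime, because prelinearity allows a proof of `c`
by cases. -/
theorem exists_prime (hF : IsImpFilter F) (hpre : ∀ a b : A, join (imp a b) (imp b a) ∈ F)
    {c : A} (hc : c ∉ F) :
    ∃ G : Set A, F ⊆ G ∧ IsImpFilter G ∧ c ∉ G ∧ ∀ a b : A, imp a b ∈ G ∨ imp b a ∈ G := by
  obtain ⟨G, hFG, hG⟩ := zorn_subset_nonempty {G : Set A | F ⊆ G ∧ IsImpFilter G ∧ c ∉ G}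
    (by
      intro C hC hchain ⟨G₀, hG₀⟩
      refine ⟨⋃₀ C, ⟨(hC hG₀).1.trans (Set.subset_sUnion_of_mem hG₀), ?_, ?_⟩,
        fun s hs => Set.subset_sUnion_of_mem hs⟩
      · refine ⟨fun a b => ⟨G₀, hG₀, (hC hG₀).2.1.weakening a b⟩,
          fun a b c => ⟨G₀, hG₀, (hC hG₀).2.1.suffixing a b c⟩,
          fun a b => ⟨G₀, hG₀, (hC hG₀).2.1.join_swap a b⟩, ?_⟩
        rintro a b ⟨G₁, h₁, ha⟩ ⟨G₂, h₂, hab⟩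
        rcases hchain.total h₁ h₂ with h | h
        · exact ⟨G₂, h₂, (hC h₂).2.1.mp (h ha) hab⟩
        · exact ⟨G₁, h₁, (hC h₁).2.1.mp ha (h hab)⟩
      · rintro ⟨G₁, h₁, hc₁⟩
        exact (hC h₁).2.2 hc₁)
    F ⟨subset_rfl, hF, hc⟩
  obtain ⟨-, hGf, hGc⟩ := hG.prop
  have key : ∀ a : A, a ∉ G → ∃ n, (imp a)^[n] c ∈ G := by
    intro a ha
    by_contra hcon
    have hsub : G ⊆ {x | ∃ n, (imp a)^[n] x ∈ G} := fun x hx => ⟨0, hx⟩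
    exact ha (hG.le_of_ge (y := {x | ∃ n, (imp a)^[n] x ∈ G})
      ⟨hFG.trans hsub, hGf.adjoin a, hcon⟩ hsub ⟨1, hGf.refl a⟩)
  refine ⟨G, hFG, hGf, hGc, fun a b => ?_⟩
  by_contra hcon
  obtain ⟨hab, hba⟩ := not_or.mp hcon
  obtain ⟨n, hn⟩ := key _ hab
  obtain ⟨m, hm⟩ := key _ hba
  exact hGc (hGf.join_elim_iterate (hFG (hpre a b)) hn hm)

end IsImpFilter

/-! ### The truth value of an element modulo a prime filter -/

/-- A proper prime implicative filter on an algebra with elements `R r`, for rational `r`, that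
satisfies the book-keeping axioms for `→` and `0` modulo the filter. -/
structure IsPrimePavelkaFilter {A : Type v} [MVOps A] (F : Set A) (R : RatI → A) : Prop where
  isImpFilter : IsImpFilter F
  exfalso : ∀ a : A, MVOps.imp MVOps.zero a ∈ F
  zero_notMem : MVOps.zero ∉ F
  prime : ∀ a b : A, MVOps.imp a b ∈ F ∨ MVOps.imp b a ∈ F
  const_zero : MVOps.imp (R MVOps.zero) MVOps.zero ∈ F
  const_imp : ∀ r s : RatI, MVOps.imp (MVOps.imp (R r) (R s)) (R (MVOps.imp r s)) ∈ F
  imp_const : ∀ r s : RatI, MVOps.imp (R (MVOps.imp r s)) (MVOps.imp (R r) (R s)) ∈ F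

/-- The real value of a rational number of the unit interval. -/
def RatI.toReal (r : RatI) : ℝ := ((r : unitInterval) : ℝ)

theorem RatI.toReal_le_one (r : RatI) : r.toReal ≤ 1 := r.1.2.2

theorem RatI.toReal_imp (r s : RatI) :
    (MVOps.imp r s : RatI).toReal = min 1 (1 - r.toReal + s.toReal) := rfl

theorem RatI.toReal_zero : (MVOps.zero : RatI).toReal = 0 := rfl

theorem RatI.toReal_injective {r s : RatI} (h : r.toReal = s.toReal) : r = s :=
  Subtype.ext (Subtype.ext h)

theorem RatI.exists_of_rat (q : ℚ) (h₀ : (0 : ℝ) ≤ q) (h₁ : (q : ℝ) ≤ 1) :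
    ∃ r : RatI, r.toReal = q :=
  ⟨⟨⟨q, h₀, h₁⟩, q, rfl⟩, rfl⟩

theorem RatI.exists_btwn {x y : ℝ} (hx : 0 ≤ x) (hy : y ≤ 1) (h : x < y) :
    ∃ r : RatI, x < r.toReal ∧ r.toReal < y := by
  obtain ⟨q, h₁, h₂⟩ := exists_rat_btwn h
  obtain ⟨r, hr⟩ := RatI.exists_of_rat q (hx.trans h₁.le) (h₂.le.trans hy)
  exact ⟨r, hr ▸ h₁, hr ▸ h₂⟩

theorem RatI.exists_near_below {x ε : ℝ} (hx₀ : 0 ≤ x) (hx₁ : x ≤ 1) (hε : 0 < ε) :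
    ∃ r : RatI, x - ε < r.toReal ∧ r.toReal ≤ x := by
  rcases hx₀.eq_or_lt with rfl | hx
  · exact ⟨MVOps.zero, by rw [RatI.toReal_zero]; linarith, le_of_eq RatI.toReal_zero⟩
  · obtain ⟨r, h₁, h₂⟩ := RatI.exists_btwn (le_max_left 0 (x - ε)) hx₁ (max_lt hx (by linarith))
    exact ⟨r, (le_max_right _ _).trans_lt h₁, h₂.le⟩

namespace IsPrimePavelkaFilter

open MVOps

variable {A : Type v} [MVOps A] {F : Set A} {R : RatI → A}

theorem const_mem_of_eq_one (h : IsPrimePavelkaFilter F R) {r : RatI} (hr : r.toReal = 1) :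
    R r ∈ F := by
  have : r = imp zero zero := RatI.toReal_injective (by rw [hr, RatI.toReal_imp]; simp)
  rw [this]
  exact h.isImpFilter.mp (h.isImpFilter.refl _) (h.const_imp _ _)

/-- If a constant `t < 1` were in the filter, then so would be its `⊙`-powers, which reach `0`. -/
theorem eq_one_of_const_mem (h : IsPrimePavelkaFilter F R) {t : RatI} (ht : R t ∈ F) :
    t.toReal = 1 := by
  by_contra hne
  have hlt : t.toReal < 1 := lt_of_le_of_ne t.toReal_le_one hne
  have key : ∀ (n : ℕ) (q : RatI), 1 - n * (1 - t.toReal) ≤ q.toReal → R q ∈ F := by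
    intro n
    induction n with
    | zero =>
      intro q hq
      exact h.const_mem_of_eq_one (le_antisymm q.toReal_le_one (by simpa using hq))
    | succ n ih =>
      intro q hq
      refine h.isImpFilter.mp ht (h.isImpFilter.mp (ih (imp t q) ?_) (h.imp_const t q))
      rw [RatI.toReal_imp]
      push_cast at hq
      have : 0 ≤ (n : ℝ) * (1 - t.toReal) := by
        have := t.toReal_le_one
        exact mul_nonneg n.cast_nonneg (by linarith)
      exact le_min (by linarith) (by linarith)
  obtain ⟨n, hn⟩ := exists_nat_gt (1 / (1 - t.toReal))
  rw [div_lt_iff₀ (by linarith)] at hn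
  exact h.zero_notMem (h.isImpFilter.mp (key n zero (by rw [RatI.toReal_zero]; linarith))
    h.const_zero)

theorem le_of_imp_const_mem (h : IsPrimePavelkaFilter F R) {r s : RatI}
    (hrs : imp (R r) (R s) ∈ F) : r.toReal ≤ s.toReal := by
  have := h.eq_one_of_const_mem (h.isImpFilter.mp hrs (h.const_imp r s))
  rw [RatI.toReal_imp, min_eq_left_iff] at this
  linarith

/-- The truth value of `a` modulo `F`, the supremum of the `r` with `R r → a` in `F`. -/
noncomputable def value (F : Set A) (R : RatI → A) (a : A) : ℝ :=
  sSup {x | ∃ r : RatI, x = r.toReal ∧ imp (R r) a ∈ F}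

theorem le_value {a : A} {r : RatI} (hr : imp (R r) a ∈ F) :
    r.toReal ≤ value F R a :=
  le_csSup ⟨1, by rintro x ⟨s, rfl, -⟩; exact s.toReal_le_one⟩ ⟨r, rfl, hr⟩

theorem value_set_nonempty (h : IsPrimePavelkaFilter F R) (a : A) :
    {x | ∃ r : RatI, x = r.toReal ∧ imp (R r) a ∈ F}.Nonempty :=
  ⟨_, zero, rfl, h.isImpFilter.trans h.const_zero (h.exfalso a)⟩

theorem value_le (h : IsPrimePavelkaFilter F R) {a : A} {r : RatI} (hr : imp a (R r) ∈ F) :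
    value F R a ≤ r.toReal := by
  refine csSup_le (h.value_set_nonempty a) ?_
  rintro x ⟨s, rfl, hs⟩
  exact h.le_of_imp_const_mem (h.isImpFilter.trans hs hr)

theorem value_nonneg (h : IsPrimePavelkaFilter F R) (a : A) : 0 ≤ value F R a :=
  le_value (r := zero) (h.isImpFilter.trans h.const_zero (h.exfalso a))

theorem value_le_one (h : IsPrimePavelkaFilter F R) (a : A) : value F R a ≤ 1 :=
  csSup_le (h.value_set_nonempty a) (by rintro x ⟨s, rfl, -⟩; exact s.toReal_le_one)

theorem exists_const_imp (h : IsPrimePavelkaFilter F R) (a : A) {ε : ℝ} (hε : 0 < ε) :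
    ∃ r : RatI, imp (R r) a ∈ F ∧ value F R a - ε < r.toReal := by
  obtain ⟨_, ⟨r, rfl, hr⟩, hlt⟩ :=
    exists_lt_of_lt_csSup (h.value_set_nonempty a) (sub_lt_self (value F R a) hε)
  exact ⟨r, hr, hlt⟩

theorem exists_imp_const (h : IsPrimePavelkaFilter F R) (a : A) {ε : ℝ} (hε : 0 < ε) :
    ∃ r : RatI, imp a (R r) ∈ F ∧ r.toReal < value F R a + ε := by
  by_cases h1 : value F R a < 1
  · obtain ⟨r, h₁, h₂⟩ := RatI.exists_btwn (h.value_nonneg a) (min_le_left 1 (value F R a + ε))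
      (lt_min h1 (by linarith))
    refine ⟨r, (h.prime a (R r)).resolve_right fun hr => ?_, h₂.trans_le (min_le_right _ _)⟩
    exact absurd (le_value hr) (not_le.mpr h₁)
  · refine ⟨imp zero zero, h.isImpFilter.imp_of_mem a (h.const_mem_of_eq_one ?_), ?_⟩
    · rw [RatI.toReal_imp]; simp
    · have := (imp zero zero : RatI).toReal_le_one
      linarith

theorem value_zero (h : IsPrimePavelkaFilter F R) : value F R zero = 0 :=
  le_antisymm (h.value_le (r := zero) (h.exfalso _)) (h.value_nonneg _)

theorem value_const (h : IsPrimePavelkaFilter F R) (r : RatI) : value F R (R r) = r.toReal :=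
  le_antisymm (h.value_le (h.isImpFilter.refl _)) (le_value (h.isImpFilter.refl _))

theorem value_eq_one (h : IsPrimePavelkaFilter F R) {a : A} (ha : a ∈ F) : value F R a = 1 := by
  refine le_antisymm (h.value_le_one a) ?_
  have := le_value (R := R) (r := imp zero zero) (h.isImpFilter.imp_of_mem _ ha)
  rw [RatI.toReal_imp] at this
  simpa using this

theorem value_mono (h : IsPrimePavelkaFilter F R) {a b : A} (hab : imp a b ∈ F) :
    value F R a ≤ value F R b := by
  refine csSup_le (h.value_set_nonempty a) ?_
  rintro x ⟨r, rfl, hr⟩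
  exact le_value (h.isImpFilter.trans hr hab)

/-- Squeezing `a` and `b` between constants squeezes `a → b` between constants. -/
theorem value_imp (h : IsPrimePavelkaFilter F R) (a b : A) :
    value F R (imp a b) = min 1 (1 - value F R a + value F R b) := by
  refine le_antisymm (le_of_forall_pos_le_add fun ε hε => ?_)
    (le_of_forall_pos_le_add fun ε hε => ?_)
  · obtain ⟨r, hr, hr'⟩ := h.exists_const_imp a (half_pos hε)
    obtain ⟨s, hs, hs'⟩ := h.exists_imp_const b (half_pos hε)
    have := h.value_le (h.isImpFilter.trans (h.isImpFilter.imp_mono hr hs) (h.const_imp r s))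
    rw [RatI.toReal_imp] at this
    rw [← min_add_add_right]
    exact le_min (by linarith [min_le_left 1 (1 - r.toReal + s.toReal)])
      (by linarith [min_le_right 1 (1 - r.toReal + s.toReal)])
  · obtain ⟨r, hr, hr'⟩ := h.exists_imp_const a (half_pos hε)
    obtain ⟨s, hs, hs'⟩ := h.exists_const_imp b (half_pos hε)
    have := le_value (h.isImpFilter.trans (h.imp_const r s) (h.isImpFilter.imp_mono hr hs))
    rw [RatI.toReal_imp, min_le_iff] at this
    rcases this with this | this
    · linarith [min_le_left 1 (1 - value F R a + value F R b)]
    · linarith [min_le_right 1 (1 - value F R a + value F R b)]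

end IsPrimePavelkaFilter

/-! ### Terms and expanded MV-algebras -/

section Terms

variable {σ : Signature.{u}} {X Y : Type*} {A : Type v} [MVOps A]

/-- The term algebra as an algebra for the primitive operations `→` and `0`. -/
instance : MVOps (Tm σ X) where
  imp := .imp
  zero := .zero

theorem Tm.eval_subst (I : Interp σ A) (e : Y → A) (s : X → Tm σ Y) (t : Tm σ X) :
    (t.subst s).eval I e = t.eval I fun x => (s x).eval I e := by
  induction t with
  | var x => rfl
  | zero => rfl
  | imp a b iha ihb => simp only [subst, eval, iha, ihb]
  | op f args ih => simp only [subst, eval, ih]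

theorem Tm.toPavelka_subst_subst {Z : Type*} (s : X → Tm σ Y) (s' : Y → Tm σ.pavelka Z)
    (t : Tm σ X) :
    (t.subst s).toPavelka.subst s' = t.toPavelka.subst fun x => (s x).toPavelka.subst s' := by
  induction t with
  | var x => rfl
  | zero => rfl
  | imp a b iha ihb => simp only [subst, toPavelka, iha, ihb]
  | op f args ih => exact congrArg (Tm.op (σ := σ.pavelka) (Sum.inl f)) (funext ih)

theorem IsCongruence.eval {I : Interp σ A} {r : Setoid A} (hr : IsCongruence I r) {e e' : X → A}
    (h : ∀ x, r (e x) (e' x)) (t : Tm σ X) : r (t.eval I e) (t.eval I e') := by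
  induction t with
  | var x => exact h x
  | zero => exact r.refl _
  | imp a b iha ihb => exact hr.1 _ _ _ _ iha ihb
  | op f args ih => exact hr.2 f _ _ ih

theorem IsCompatible.isCongruence {E : Set (Fm σ × Fm σ)} (hE : IsCompatible E) {A : Type u}
    [MVOps A] {I : Interp σ A} (hI : InVariety E I) {r : Setoid A} (hr : IsMVCongruence r) :
    IsCongruence I r := by
  have : r ∈ {r : Setoid A | IsMVCongruence r} := hr
  rwa [← hE A I hI] at this

theorem IsMV.imp_self (h : IsMV A) (x : A) : MVOps.imp x x = MVOps.one := by
  have hj : ∀ y : A, MVOps.join y y = y := fun y => by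
    have := h.join_meet y MVOps.one
    rwa [h.meet_one] at this
  rw [← hj (MVOps.imp x x)]
  exact h.prelinearity x x

theorem IsMV.eq_of_imp_eq_one (h : IsMV A) {x y : A} (hxy : MVOps.imp x y = MVOps.one)
    (hyx : MVOps.imp y x = MVOps.one) : x = y := by
  have hx : MVOps.meet x y = x := by rw [MVOps.meet, hxy, h.odot_one]
  have hy : MVOps.meet y x = y := by rw [MVOps.meet, hyx, h.odot_one]
  rw [← hx, h.meet_comm, hy]

/-- The assignment of the elements `x, y, z` to the variables `p₀, p₁, p₂`. -/
def assign₃ (x y z : A) : ℕ → A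
  | 0 => x
  | 1 => y
  | _ => z

open MVOps in
/-- The defining identities of MV-algebras, as equations between terms. -/
def mvEquations (σ : Signature.{u}) : Set (Fm σ × Fm σ) :=
  let x : Fm σ := .var 0
  let y : Fm σ := .var 1
  let z : Fm σ := .var 2
  {(odot (odot x y) z, odot x (odot y z)), (odot x y, odot y x), (odot x one, x),
    (meet (meet x y) z, meet x (meet y z)), (meet x y, meet y x),
    (join (join x y) z, join x (join y z)), (join x y, join y x),
    (meet x (join x y), x), (join x (meet x y), x), (join x zero, x), (meet x one, x),
    (imp (odot x y) z, imp x (imp y z)), (meet (odot (imp x y) x) y, odot (imp x y) x),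
    (imp (meet x y) y, one), (odot x (imp x y), meet x y),
    (join (imp x y) (imp y x), one), (imp (imp x zero) zero, x)}

theorem isMV_iff (I : Interp σ A) :
    IsMV A ↔ ∀ eq ∈ mvEquations σ, ∀ e : ℕ → A, eq.1.eval I e = eq.2.eval I e := by
  constructor
  · intro h eq heq e
    simp only [mvEquations, Set.mem_insert_iff, Set.mem_singleton_iff] at heq
    rcases heq with rfl | rfl | rfl | rfl | rfl | rfl | rfl | rfl | rfl | rfl | rfl | rfl | rfl |
      rfl | rfl | rfl | rfl
    · exact h.odot_assoc (e 0) (e 1) (e 2)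
    · exact h.odot_comm (e 0) (e 1)
    · exact h.odot_one (e 0)
    · exact h.meet_assoc (e 0) (e 1) (e 2)
    · exact h.meet_comm (e 0) (e 1)
    · exact h.join_assoc (e 0) (e 1) (e 2)
    · exact h.join_comm (e 0) (e 1)
    · exact h.meet_join (e 0) (e 1)
    · exact h.join_meet (e 0) (e 1)
    · exact h.join_zero (e 0)
    · exact h.meet_one (e 0)
    · exact h.residuation (e 0) (e 1) (e 2)
    · exact h.counit (e 0) (e 1)
    · exact h.meet_imp (e 0) (e 1)
    · exact h.divisibility (e 0) (e 1)
    · exact h.prelinearity (e 0) (e 1)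
    · exact h.involution (e 0)
  · intro h
    simp only [mvEquations, Set.forall_mem_insert, Set.mem_singleton_iff, forall_eq] at h
    obtain ⟨h1, h2, h3, h4, h5, h6, h7, h8, h9, h10, h11, h12, h13, h14, h15, h16, h17⟩ := h
    exact
    { odot_assoc := fun x y z => h1 (assign₃ x y z)
      odot_comm := fun x y => h2 (assign₃ x y y)
      odot_one := fun x => h3 (assign₃ x x x)
      meet_assoc := fun x y z => h4 (assign₃ x y z)
      meet_comm := fun x y => h5 (assign₃ x y y)
      join_assoc := fun x y z => h6 (assign₃ x y z)
      join_comm := fun x y => h7 (assign₃ x y y)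
      meet_join := fun x y => h8 (assign₃ x y y)
      join_meet := fun x y => h9 (assign₃ x y y)
      join_zero := fun x => h10 (assign₃ x x x)
      meet_one := fun x => h11 (assign₃ x x x)
      residuation := fun x y z => h12 (assign₃ x y z)
      counit := fun x y => h13 (assign₃ x y y)
      meet_imp := fun x y => h14 (assign₃ x y y)
      divisibility := fun x y => h15 (assign₃ x y y)
      prelinearity := fun x y => h16 (assign₃ x y y)
      involution := fun x => h17 (assign₃ x x x) }

theorem inVariety_iff {E : Set (Fm σ × Fm σ)} {I : Interp σ A} :
    InVariety E I ↔
      ∀ eq ∈ mvEquations σ ∪ E, ∀ e : ℕ → A, eq.1.eval I e = eq.2.eval I e := by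
  constructor
  · rintro h eq (heq | heq)
    · exact (isMV_iff I).mp h.isMV eq heq
    · exact h.sat eq heq
  · exact fun h => ⟨(isMV_iff I).mpr fun eq heq => h eq (.inl heq), fun eq heq => h eq (.inr heq)⟩

end Terms

/-! ### Completeness of the expanded logic with respect to its variety -/

section Completeness

variable {σ : Signature.{u}} {Ax : Set (Fm σ)} {E : Set (Fm σ × Fm σ)}

theorem Derivable.isImpFilter (Ax Γ : Set (Fm σ)) : IsImpFilter {a | Derivable Ax Γ a} where
  weakening := .luk1
  suffixing := .luk2
  join_swap := .luk4
  mp := .mp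

/-- The elements of an algebra that satisfy the defining equations `δ ≈ ε` in `D`. -/
def defSet (D : Finset (Tm σ (Fin 1) × Tm σ (Fin 1))) {A : Type v} [MVOps A] (I : Interp σ A) :
    Set A :=
  {x | ∀ d ∈ D, d.1.eval I (fun _ => x) = d.2.eval I fun _ => x}

theorem forall_defEqs_iff {D : Finset (Tm σ (Fin 1) × Tm σ (Fin 1))} {A : Type v} [MVOps A]
    {I : Interp σ A} {e : ℕ → A} {Γ : Set (Fm σ)} :
    (∀ th ∈ defEqs D Γ, th.1.eval I e = th.2.eval I e) ↔ ∀ a ∈ Γ, a.eval I e ∈ defSet D I := by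
  have hfun : ∀ a : Fm σ, (fun i : Fin 1 => ((![a] i).eval I e)) = fun _ => a.eval I e :=
    fun a => funext fun i => by rw [Fin.eq_zero i]; rfl
  constructor
  · intro h a ha d hd
    have := h _ ⟨a, ha, d, hd, rfl⟩
    simpa only [Tm.eval_subst, hfun] using this
  · rintro h _ ⟨a, ha, d, hd, rfl⟩
    simp only [Tm.eval_subst, hfun]
    exact h a ha d hd

/-- The defining equations of an algebraizable expansion are equivalent to `x ≈ 1`. The solution set
is a filter, whose congruence respects the new operations by compatibility; hence it identifies
the values of `x ⇔ 1` and `1 ⇔ 1` for each solution `x`, so that `x ⇔ 1` is a solution as well. -/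
theorem defSet_eq_singleton (hE : IsCompatible E) {Eqv : Finset (Tm σ (Fin 2))}
    {D : Finset (Tm σ (Fin 1) × Tm σ (Fin 1))}
    (hD : ∀ (Γ : Set (Fm σ)), Γ.Finite → ∀ a : Fm σ,
      Derivable Ax Γ a ↔ ∀ eq ∈ defEqs D {a}, EqConseq E (defEqs D Γ) eq)
    (hEqv : ∀ a b : Fm σ,
      (∀ eq ∈ defEqs D (eqvFms Eqv a b), EqConseq E {(a, b)} eq) ∧
        EqConseq E (defEqs D (eqvFms Eqv a b)) (a, b))
    {A : Type u} [MVOps A] {I : Interp σ A} (hI : InVariety E I) :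
    defSet D I = {MVOps.one} := by
  have sound : ∀ (Γ : Set (Fm σ)), Γ.Finite → ∀ a : Fm σ, Derivable Ax Γ a → ∀ e : ℕ → A,
      (∀ b ∈ Γ, b.eval I e ∈ defSet D I) → a.eval I e ∈ defSet D I := by
    intro Γ hΓ a ha e he
    refine forall_defEqs_iff.mp (fun eq heq => ?_) a (Set.mem_singleton a)
    exact (hD Γ hΓ a).mp ha eq heq A I hI e (forall_defEqs_iff.mpr he)
  have sound₀ : ∀ a : Fm σ, Derivable Ax ∅ a → ∀ e : ℕ → A, a.eval I e ∈ defSet D I :=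
    fun a ha e => sound ∅ Set.finite_empty a ha e fun b hb => hb.elim
  have hF : IsImpFilter (defSet D I) :=
    { weakening := fun x y => sound₀ _ (.luk1 (.var 0) (.var 1)) (assign₃ x y y)
      suffixing := fun x y z => sound₀ _ (.luk2 (.var 0) (.var 1) (.var 2)) (assign₃ x y z)
      join_swap := fun x y => sound₀ _ (.luk4 (.var 0) (.var 1)) (assign₃ x y y)
      mp := fun {x y} hx hxy => by
        refine sound {.var 0, .imp (.var 0) (.var 1)} (by simp) (.var 1)
          (.mp (.hyp (.inl rfl)) (.hyp (.inr rfl))) (assign₃ x y y) ?_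
        rintro b (rfl | rfl)
        · exact hx
        · exact hxy }
  have hone : (MVOps.one : A) ∈ defSet D I := hF.refl _
  refine Set.Subset.antisymm (fun x hx => ?_) (Set.singleton_subset_iff.mpr hone)
  -- Evaluate `p₀ ⇔ p₁` at `x, 1` and at `1, 1`.
  have hcong := hE.isCongruence hI hF.isMVCongruence_setoid
  have hfun : ∀ e : ℕ → A, (fun i : Fin 2 => ((![Tm.var 0, Tm.var 1] i : Fm σ).eval I e)) =
      ![e 0, e 1] := fun e => funext fun i => by fin_cases i <;> rfl
  refine (hEqv (.var 0) (.var 1)).2 A I hI (assign₃ x MVOps.one MVOps.one)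
    (forall_defEqs_iff.mpr ?_)
  rintro _ ⟨t, ht, rfl⟩
  have h11 : (t.subst ![Tm.var 0, Tm.var 1] : Fm σ).eval I
      (assign₃ MVOps.one MVOps.one MVOps.one) ∈ defSet D I := by
    refine (forall_defEqs_iff (Γ := eqvFms Eqv (.var 0) (.var 1))).mp (fun eq heq => ?_) _
      ⟨t, ht, rfl⟩
    exact (hEqv (.var 0) (.var 1)).1 eq heq A I hI _ (by rintro _ rfl; rfl)
  rw [Tm.eval_subst, hfun] at h11 ⊢
  refine hF.mp h11 (hcong.eval (fun i => ?_) t).2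
  fin_cases i
  · exact ⟨hF.imp_of_mem _ hone, hF.imp_of_mem _ hx⟩
  · exact hF.setoid.refl _

theorem IsAdmissibleExpansion.derivable_iff (h : IsAdmissibleExpansion Ax E) {Γ : Set (Fm σ)}
    (hΓ : Γ.Finite) (a : Fm σ) :
    Derivable Ax Γ a ↔ ∀ (A : Type u) [MVOps A] (I : Interp σ A), InVariety E I → ∀ e : ℕ → A,
      (∀ b ∈ Γ, b.eval I e = MVOps.one) → a.eval I e = MVOps.one := by
  obtain ⟨Eqv, D, hD, hEqv⟩ := h.algebraizable
  have hone : ∀ (A : Type u) [MVOps A] (I : Interp σ A), InVariety E I → ∀ x : A,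
      x ∈ defSet D I ↔ x = MVOps.one := fun A _ I hI x => by
    rw [defSet_eq_singleton h.admissible.compatible hD hEqv hI, Set.mem_singleton_iff]
  rw [hD Γ hΓ a]
  constructor
  · intro H A _ I hI e he
    refine (hone A I hI _).mp (forall_defEqs_iff.mp (fun eq heq => ?_) a (Set.mem_singleton a))
    exact H eq heq A I hI e (forall_defEqs_iff.mpr fun b hb => (hone A I hI _).mpr (he b hb))
  · intro H eq heq A _ I hI e he
    refine forall_defEqs_iff.mpr (fun b hb => ?_) eq heq
    rw [Set.mem_singleton_iff.mp hb, hone A I hI]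
    exact H A I hI e fun c hc => (hone A I hI _).mp (forall_defEqs_iff.mp he c hc)

end Completeness

/-! ### Theories of the Pavelka expansion and their Lindenbaum algebras -/

section Theories

variable {σ : Signature.{u}} {Ax : Set (Fm σ)} {E : Set (Fm σ × Fm σ)} {J : Interp σ RatI}
  {T : Set (Fm σ.pavelka)}

theorem IsTheory.isImpFilter {Ax T : Set (Fm σ)} (hT : IsTheory Ax T) : IsImpFilter T where
  weakening a b := hT _ (.luk1 a b)
  suffixing a b c := hT _ (.luk2 a b c)
  join_swap a b := hT _ (.luk4 a b)
  mp ha hab := hT _ (.mp (.hyp ha) (.hyp hab))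

theorem IsTheory.of_isImpFilter {Ax T F : Set (Fm σ)} (hT : IsTheory Ax T) (hTF : T ⊆ F)
    (hF : IsImpFilter F) : IsTheory Ax F := by
  intro a ha
  induction ha with
  | hyp h => exact h
  | luk1 a b => exact hF.weakening a b
  | luk2 a b c => exact hF.suffixing a b c
  | luk3 a b => exact hTF (hT _ (.luk3 a b))
  | luk4 a b => exact hF.join_swap a b
  | ax h s => exact hTF (hT _ (.ax h s))
  | mp _ _ ih₁ ih₂ => exact hF.mp ih₁ ih₂

theorem IsTheory.zero_imp_mem {Ax T : Set (Fm σ)} (hT : IsTheory Ax T) (a : Fm σ) :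
    Tm.imp .zero a ∈ T :=
  hT.isImpFilter.mp (hT.isImpFilter.imp_of_mem a.neg (hT.isImpFilter.refl (.zero : Fm σ)))
    (hT _ (.luk3 a .zero))

theorem IsTheory.subst_mem (hT : IsTheory (pavelkaAx Ax J) T) {Γ : Set (Fm σ)} {a : Fm σ}
    (ha : Derivable Ax Γ a) (s : ℕ → Fm σ.pavelka) (hΓ : ∀ b ∈ Γ, b.toPavelka.subst s ∈ T) :
    a.toPavelka.subst s ∈ T := by
  induction ha with
  | hyp h => exact hΓ _ h
  | luk1 a b => exact hT _ (.luk1 _ _)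
  | luk2 a b c => exact hT _ (.luk2 _ _ _)
  | luk3 a b => exact hT _ (.luk3 _ _)
  | luk4 a b => exact hT _ (.luk4 _ _)
  | ax h s' =>
    rw [Tm.toPavelka_subst_subst]
    exact hT _ (.ax (.inl ⟨_, h, rfl⟩) _)
  | mp _ _ ih₁ ih₂ => exact hT.isImpFilter.mp ih₁ ih₂

theorem IsTheory.subst_mem_of_valid (h : IsAdmissibleExpansion Ax E)
    (hT : IsTheory (pavelkaAx Ax J) T) {a : Fm σ}
    (ha : ∀ (A : Type u) [MVOps A] (I : Interp σ A), InVariety E I → ∀ e : ℕ → A,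
      a.eval I e = MVOps.one) (s : ℕ → Fm σ.pavelka) : a.toPavelka.subst s ∈ T :=
  hT.subst_mem ((h.derivable_iff Set.finite_empty a).mpr fun A _ I hI e _ => ha A I hI e) s
    fun _ hb => hb.elim

theorem IsTheory.setoid_of_mem_equations (h : IsAdmissibleExpansion Ax E)
    (hT : IsTheory (pavelkaAx Ax J) T) {eq : Fm σ × Fm σ} (heq : eq ∈ mvEquations σ ∪ E)
    (s : ℕ → Fm σ.pavelka) :
    hT.isImpFilter.setoid (eq.1.toPavelka.subst s) (eq.2.toPavelka.subst s) := by
  constructor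
  · refine hT.subst_mem_of_valid h (a := .imp eq.1 eq.2) (fun A _ I hI e => ?_) s
    rw [Tm.eval, inVariety_iff.mp hI eq heq e, hI.isMV.imp_self]
  · refine hT.subst_mem_of_valid h (a := .imp eq.2 eq.1) (fun A _ I hI e => ?_) s
    rw [Tm.eval, inVariety_iff.mp hI eq heq e, hI.isMV.imp_self]

theorem IsTheory.prelinearity_mem (h : IsAdmissibleExpansion Ax E)
    (hT : IsTheory (pavelkaAx Ax J) T) (a b : Fm σ.pavelka) :
    MVOps.join (MVOps.imp a b) (MVOps.imp b a) ∈ T :=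
  hT.subst_mem_of_valid h
    (a := MVOps.join (MVOps.imp (.var 0) (.var 1)) (MVOps.imp (.var 1) (.var 0)))
    (fun _ _ _ hI e => hI.isMV.prelinearity (e 0) (e 1)) (assign₃ a b b)

/-- Theories are closed under replacement inside the connectives of `σ`: in the variety, the
premises `xᵢ → yᵢ` and `yᵢ → xᵢ` mean `xᵢ = yᵢ`. -/
theorem IsTheory.setoid_op (h : IsAdmissibleExpansion Ax E)
    (hT : IsTheory (pavelkaAx Ax J) T) (f : σ.Op) {x y : Fin (σ.ar f) → Fm σ.pavelka}
    (hxy : ∀ i, hT.isImpFilter.setoid (x i) (y i)) :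
    hT.isImpFilter.setoid (.op (σ := σ.pavelka) (Sum.inl f) x)
      (.op (σ := σ.pavelka) (Sum.inl f) y) := by
  suffices H : ∀ x y : Fin (σ.ar f) → Fm σ.pavelka,
      (∀ i, hT.isImpFilter.setoid (x i) (y i)) →
        Tm.imp (.op (σ := σ.pavelka) (Sum.inl f) x) (.op (σ := σ.pavelka) (Sum.inl f) y) ∈ T from
    ⟨H x y hxy, H y x fun i => hT.isImpFilter.setoid.symm (hxy i)⟩
  intro x y hxy
  let p : Fin (σ.ar f) → Fm σ := fun i => .var i
  let q : Fin (σ.ar f) → Fm σ := fun i => .var (σ.ar f + i)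
  -- The substitution taking `p i` to `x i` and `q i` to `y i`.
  let s : ℕ → Fm σ.pavelka := fun n =>
    if h : n < σ.ar f then x ⟨n, h⟩
    else if h : n - σ.ar f < σ.ar f then y ⟨n - σ.ar f, h⟩ else .zero
  have hp : ∀ i, (p i).toPavelka.subst s = x i := fun i => by
    simp [p, s, Tm.toPavelka, Tm.subst]
  have hq : ∀ i, (q i).toPavelka.subst s = y i := fun i => by
    simp [q, s, Tm.toPavelka, Tm.subst]
  have hder : Derivable Ax
      (Set.range (fun i => Tm.imp (p i) (q i)) ∪ Set.range fun i => Tm.imp (q i) (p i))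
      (.imp (.op f p) (.op f q)) := by
    refine (h.derivable_iff ((Set.finite_range _).union (Set.finite_range _)) _).mpr ?_
    intro A _ I hI e he
    have : (fun i => (p i).eval I e) = fun i => (q i).eval I e := funext fun i =>
      hI.isMV.eq_of_imp_eq_one (he _ (.inl ⟨i, rfl⟩)) (he _ (.inr ⟨i, rfl⟩))
    rw [Tm.eval, Tm.eval, Tm.eval, this, hI.isMV.imp_self]
  have := hT.subst_mem hder s (by
    rintro _ (⟨i, rfl⟩ | ⟨i, rfl⟩)
    · simp only [Tm.toPavelka, Tm.subst, hp, hq]; exact (hxy i).1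
    · simp only [Tm.toPavelka, Tm.subst, hp, hq]; exact (hxy i).2)
  have heq : (Tm.imp (.op f p) (.op f q) : Fm σ).toPavelka.subst s =
      .imp (.op (σ := σ.pavelka) (Sum.inl f) x) (.op (σ := σ.pavelka) (Sum.inl f) y) :=
    congrArg₂ Tm.imp (congrArg (Tm.op (σ := σ.pavelka) (Sum.inl f)) (funext hp))
      (congrArg (Tm.op (σ := σ.pavelka) (Sum.inl f)) (funext hq))
  rwa [heq] at this

/-- A homomorphic image of the algebra of formulas that identifies formulas equivalent over a
theory lies in the variety. -/
theorem IsTheory.inVariety_of_surjective (h : IsAdmissibleExpansion Ax E)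
    (hT : IsTheory (pavelkaAx Ax J) T) {A : Type v} [MVOps A] {I : Interp σ A}
    {g : Fm σ.pavelka → A} (hg : Function.Surjective g) (hzero : g .zero = MVOps.zero)
    (himp : ∀ a b, g (.imp a b) = MVOps.imp (g a) (g b))
    (hop : ∀ (f : σ.Op) (x : Fin (σ.ar f) → Fm σ.pavelka),
      g (.op (σ := σ.pavelka) (Sum.inl f) x) = I f fun i => g (x i))
    (hker : ∀ a b, hT.isImpFilter.setoid a b → g a = g b) : InVariety E I := by
  refine inVariety_iff.mpr fun eq heq e => ?_
  obtain ⟨s, rfl⟩ := hg.comp_left (α := ℕ) e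
  have hev : ∀ t : Fm σ, t.eval I (g ∘ s) = g (t.toPavelka.subst s) := by
    intro t
    induction t with
    | var x => rfl
    | zero => exact hzero.symm
    | imp a b iha ihb => simp only [Tm.eval, Tm.toPavelka, Tm.subst, himp, iha, ihb]
    | op f args ih =>
      simp only [Tm.eval, ih]
      exact (hop f _).symm
  rw [hev, hev]
  exact hker _ _ (hT.setoid_of_mem_equations h heq s)

/-- The Lindenbaum algebra of a theory. -/
def Lindenbaum (hT : IsTheory (pavelkaAx Ax J) T) : Type u := Quotient hT.isImpFilter.setoid

namespace Lindenbaum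

variable (hT : IsTheory (pavelkaAx Ax J) T)

/-- The equivalence class of a formula over a theory. -/
def mk (a : Fm σ.pavelka) : Lindenbaum hT := Quotient.mk _ a

theorem mk_surjective : Function.Surjective (mk hT) := Quotient.mk_surjective

theorem mk_eq_mk {a b : Fm σ.pavelka} : mk hT a = mk hT b ↔ hT.isImpFilter.setoid a b :=
  Quotient.eq

instance : MVOps (Lindenbaum hT) where
  imp := Quotient.map₂ Tm.imp fun _ _ h₁ _ _ h₂ =>
    hT.isImpFilter.isMVCongruence_setoid _ _ _ _ h₁ h₂
  zero := mk hT .zero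

/-- The connectives of `σ` on the Lindenbaum algebra, computed on representatives. -/
noncomputable def interp : Interp σ (Lindenbaum hT) := fun f x =>
  mk hT (.op (σ := σ.pavelka) (Sum.inl f) fun i => (mk_surjective hT (x i)).choose)

theorem mk_op (h : IsAdmissibleExpansion Ax E) (f : σ.Op) (x : Fin (σ.ar f) → Fm σ.pavelka) :
    mk hT (.op (σ := σ.pavelka) (Sum.inl f) x) = interp hT f fun i => mk hT (x i) :=
  (mk_eq_mk hT).mpr (hT.setoid_op h f fun i =>
    (mk_eq_mk hT).mp (mk_surjective hT (mk hT (x i))).choose_spec.symm)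

theorem inVariety (h : IsAdmissibleExpansion Ax E) : InVariety E (interp hT) :=
  hT.inVariety_of_surjective h (mk_surjective hT) rfl (fun _ _ => rfl) (mk_op hT h)
    fun _ _ => (mk_eq_mk hT).mpr

end Lindenbaum

/-- An `→`-preserving map of formulas whose kernel contains equivalence over a theory has a kernel
compatible with the connectives of `σ`, by compatibility of the Lindenbaum algebra. -/
theorem IsTheory.map_op_eq (h : IsAdmissibleExpansion Ax E)
    (hT : IsTheory (pavelkaAx Ax J) T) {A : Type v} [MVOps A] {g : Fm σ.pavelka → A}
    (himp : ∀ a b, g (.imp a b) = MVOps.imp (g a) (g b))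
    (hker : ∀ a b, hT.isImpFilter.setoid a b → g a = g b) (f : σ.Op)
    {x y : Fin (σ.ar f) → Fm σ.pavelka} (hxy : ∀ i, g (x i) = g (y i)) :
    g (.op (σ := σ.pavelka) (Sum.inl f) x) = g (.op (σ := σ.pavelka) (Sum.inl f) y) := by
  let g' : Lindenbaum hT → A := Quotient.lift g hker
  have himp' : ∀ a b, g' (MVOps.imp a b) = MVOps.imp (g' a) (g' b) := by
    intro a b
    obtain ⟨a, rfl⟩ := Lindenbaum.mk_surjective hT a
    obtain ⟨b, rfl⟩ := Lindenbaum.mk_surjective hT b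
    exact himp a b
  have hmv : IsMVCongruence (Setoid.ker g') := by
    intro a a' b b' ha hb
    rw [Setoid.ker_def] at ha hb ⊢
    rw [himp', himp', ha, hb]
  have := (h.admissible.compatible.isCongruence (Lindenbaum.inVariety hT h) hmv).2 f
    (fun i => Lindenbaum.mk hT (x i)) (fun i => Lindenbaum.mk hT (y i)) hxy
  rw [← Lindenbaum.mk_op hT h, ← Lindenbaum.mk_op hT h] at this
  exact this

end Theories

open Filter Topology

/-! ### Dense subalgebras of the unit interval -/

section Dense

variable {σ : Signature.{u}} {E : Set (Fm σ × Fm σ)} {B : MVSub unitInterval}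
  {IB : Interp σ B.carrier}

/-- The pointwise MV-operations on sequences. The lift puts subalgebras of `[0,1]` in the universe
over which compatibility quantifies. -/
instance (A : Type v) [MVOps A] : MVOps (ℕ → ULift.{u} A) where
  imp x y n := ⟨MVOps.imp (x n).down (y n).down⟩
  zero _ := ⟨MVOps.zero⟩

/-- The pointwise interpretation of the symbols of `σ` on sequences. -/
def seqInterp {A : Type v} (I : Interp σ A) : Interp σ (ℕ → ULift.{u} A) :=
  fun f x n => ⟨I f fun i => (x i n).down⟩

theorem eval_seqInterp {A : Type v} [MVOps A] (I : Interp σ A) (e : ℕ → ℕ → ULift.{u} A)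
    (t : Fm σ) (n : ℕ) : (t.eval (seqInterp I) e n).down = t.eval I fun j => (e j n).down := by
  induction t with
  | var x => rfl
  | zero => rfl
  | imp a b iha ihb => rw [Tm.eval, Tm.eval, ← iha, ← ihb]; rfl
  | op f args ih => simp only [Tm.eval, ← ih]; rfl

theorem InVariety.seq {A : Type v} [MVOps A] {I : Interp σ A} (hI : InVariety E I) :
    InVariety E (seqInterp I) := by
  refine inVariety_iff.mpr fun eq heq e => funext fun n => ULift.ext _ _ ?_
  rw [eval_seqInterp, eval_seqInterp]
  exact inVariety_iff.mp hI eq heq _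

theorem coe_imp (x y : unitInterval) :
    ((MVOps.imp x y : unitInterval) : ℝ) = min 1 (1 - (x : ℝ) + y) := rfl

theorem continuous_imp :
    Continuous fun p : unitInterval × unitInterval => (MVOps.imp p.1 p.2 : unitInterval) :=
  Continuous.subtype_mk (by fun_prop) _

theorem dist_imp_le (x x' y y' : unitInterval) :
    dist (MVOps.imp x y) (MVOps.imp x' y') ≤ dist x x' + dist y y' := by
  simp only [Subtype.dist_eq, coe_imp, Real.dist_eq]
  refine (abs_min_sub_min_le_max _ _ _ _).trans (max_le (by simp; positivity) ?_)
  calc |1 - (x : ℝ) + y - (1 - x' + y')| = |(y - y' : ℝ) - (x - x')| := by ring_nf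
    _ ≤ |(y - y' : ℝ)| + |(x - x' : ℝ)| := abs_sub _ _
    _ = _ := add_comm _ _

/-- Compatibility makes the operations of a subalgebra of the unit interval uniformly continuous:
on the power `B^ℕ`, the relation `dist (xₙ) (yₙ) → 0` is a congruence of the MV-reduct. -/
theorem IsCompatible.tendsto_dist (hE : IsCompatible E) (hB : InVariety E IB) (f : σ.Op)
    {x y : ℕ → Fin (σ.ar f) → B.carrier}
    (hxy : ∀ i, Tendsto (fun n => dist (x n i) (y n i)) atTop (𝓝 0)) :
    Tendsto (fun n => dist (IB f (x n)) (IB f (y n))) atTop (𝓝 0) := by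
  let r : Setoid (ℕ → ULift.{u} B.carrier) :=
    { r := fun x y => Tendsto (fun n => dist (x n).down (y n).down) atTop (𝓝 0)
      iseqv :=
        ⟨fun x => by simp, fun h => by simpa only [dist_comm] using h,
          fun h k => squeeze_zero (fun _ => dist_nonneg) (fun _ => dist_triangle _ _ _)
            (by simpa using h.add k)⟩ }
  have hr : IsMVCongruence r := fun x x' y y' hx hy =>
    squeeze_zero (fun _ => dist_nonneg)
      (fun n => dist_imp_le (x n).down.1 (x' n).down.1 (y n).down.1 (y' n).down.1)
      (by
        have := Tendsto.add hx hy
        rw [add_zero] at this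
        exact this)
  exact (hE.isCongruence hB.seq hr).2 f (fun i n => ⟨x n i⟩) (fun i n => ⟨y n i⟩) hxy

/-- Images under an operation of a subalgebra of sequences converging in the unit interval
converge. -/
theorem IsCompatible.exists_tendsto (hE : IsCompatible E) (hB : InVariety E IB) (f : σ.Op)
    {x : ℕ → Fin (σ.ar f) → B.carrier} {l : Fin (σ.ar f) → unitInterval}
    (hx : ∀ i, Tendsto (fun n => (x n i : unitInterval)) atTop (𝓝 (l i))) :
    ∃ m, Tendsto (fun n => (IB f (x n) : unitInterval)) atTop (𝓝 m) := by
  refine cauchySeq_tendsto_of_complete ?_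
  rw [Metric.cauchySeq_iff']
  by_contra! hcon
  obtain ⟨ε, hε, hcon⟩ := hcon
  -- Compare `x` with the subsequence `x ∘ φ`, whose images stay at distance at least `ε`.
  choose φ hφ hφε using hcon
  have hφt : Tendsto φ atTop atTop := tendsto_atTop_mono hφ tendsto_id
  have := hE.tendsto_dist hB f (x := fun n => x (φ n)) (y := x) fun i => by
    have := ((hx i).comp hφt).dist (hx i)
    rw [dist_self] at this
    exact this
  exact not_le.mpr hε (ge_of_tendsto' this hφε)

/-- The operations of a dense subalgebra that carries an expansion in the variety are the
restrictions of the operations of the unit interval: they extend by continuity, the extensions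
satisfy the equations of the variety, and the expansion of the unit interval is unique. -/
theorem IsAdmissibleVariety.coe_interp_eq (hE : IsAdmissibleVariety E) (hB : InVariety E IB)
    (hd : Dense B.carrier) {I : Interp σ unitInterval} (hI : InVariety E I) (f : σ.Op)
    (x : Fin (σ.ar f) → B.carrier) : (IB f x : unitInterval) = I f fun i => x i := by
  have happrox : ∀ l : unitInterval, ∃ b : ℕ → B.carrier,
      Tendsto (fun n => (b n : unitInterval)) atTop (𝓝 l) := fun l => by
    obtain ⟨b, hb, hbl⟩ := mem_closure_iff_seq_limit.mp (hd l)
    exact ⟨fun n => ⟨b n, hb n⟩, hbl⟩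
  -- `K f l` is the limit of the values of `f` along chosen approximations of the arguments `l`.
  choose b hb using happrox
  choose K hK using fun (f : σ.Op) (l : Fin (σ.ar f) → unitInterval) =>
    hE.compatible.exists_tendsto hB f (x := fun n i => b (l i) n) fun i => hb (l i)
  have hlim : ∀ (f : σ.Op) (l : Fin (σ.ar f) → unitInterval) (x : ℕ → Fin (σ.ar f) → B.carrier),
      (∀ i, Tendsto (fun n => (x n i : unitInterval)) atTop (𝓝 (l i))) →
        Tendsto (fun n => (IB f (x n) : unitInterval)) atTop (𝓝 (K f l)) := by
    intro f l x hx
    refine (tendsto_iff_of_dist (f₁ := fun n => (IB f fun i => b (l i) n : unitInterval))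
      (hE.compatible.tendsto_dist hB f fun i => ?_)).mp (hK f l)
    have := (hb (l i)).dist (hx i)
    rw [dist_self] at this
    exact this
  have heval : ∀ (t : Fm σ) (e : ℕ → unitInterval),
      Tendsto (fun n => ((t.eval IB fun j => b (e j) n : B.carrier) : unitInterval)) atTop
        (𝓝 (t.eval K e)) := by
    intro t e
    induction t with
    | var j => exact hb (e j)
    | zero => exact tendsto_const_nhds
    | imp a c iha ihc => exact (continuous_imp.tendsto _).comp (iha.prodMk_nhds ihc)
    | op f args ih => exact hlim f _ _ ih
  have hKE : InVariety E K := by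
    refine inVariety_iff.mpr fun eq heq e => tendsto_nhds_unique (heval eq.1 e) ?_
    simp_rw [inVariety_iff.mp hB eq heq]
    exact heval eq.2 e
  rw [hE.canonical.1.unique hI hKE]
  exact tendsto_nhds_unique tendsto_const_nhds
    (hlim f _ (fun _ => x) fun _ => tendsto_const_nhds)

theorem dense_of_forall_mem {s : Set unitInterval} (hs : ∀ r : RatI, (r : unitInterval) ∈ s) :
    Dense s := by
  refine Metric.dense_iff.mpr fun x ε hε => ?_
  obtain ⟨r, h₁, h₂⟩ := RatI.exists_near_below x.2.1 x.2.2 hε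
  refine ⟨r, ?_, hs r⟩
  rw [Metric.mem_ball, Subtype.dist_eq, Real.dist_eq, abs_lt]
  constructor
  · change -ε < r.toReal - x
    linarith
  · change r.toReal - x < ε
    linarith

end Dense

/-! ### Valuations from prime theories -/

section Valuation

variable {σ : Signature.{u}} {Ax : Set (Fm σ)} {E : Set (Fm σ × Fm σ)} {J : Interp σ RatI}
  {T : Set (Fm σ.pavelka)}

theorem truthConst_subst (r : RatI) (s : ℕ → Fm σ.pavelka) :
    (truthConst r : Fm σ.pavelka).subst s = truthConst r :=
  congrArg (Tm.op (σ := σ.pavelka) (Sum.inr r)) (funext fun i => i.elim0)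

theorem eval_truthConst (I : Interp σ unitInterval) (e : ℕ → unitInterval) (r : RatI) :
    (truthConst r : Fm σ.pavelka).eval I.pavelka e = r := rfl

theorem op_inr_eq_truthConst (r : RatI)
    (x : Fin (σ.pavelka.ar (Sum.inr r)) → Fm σ.pavelka) :
    Tm.op (σ := σ.pavelka) (Sum.inr r) x = truthConst r :=
  congrArg (Tm.op (σ := σ.pavelka) (Sum.inr r)) (funext fun i => i.elim0)

theorem IsTheory.isPrimePavelkaFilter (hT : IsTheory (pavelkaAx Ax J) T) {c : Fm σ.pavelka}
    (hc : c ∉ T) (hprime : ∀ a b : Fm σ.pavelka, MVOps.imp a b ∈ T ∨ MVOps.imp b a ∈ T) :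
    IsPrimePavelkaFilter T truthConst where
  isImpFilter := hT.isImpFilter
  exfalso := hT.zero_imp_mem
  zero_notMem h := hc (hT.isImpFilter.mp h (hT.zero_imp_mem c))
  prime := hprime
  const_zero := by
    have := hT _ (.ax (.inr (.inl (.inl (.inl rfl)))) Tm.var)
    rwa [Tm.subst, truthConst_subst] at this
  const_imp r s := by
    have := hT _ (.ax (.inr (.inl (.inr (Set.mem_iUnion₂.mpr ⟨r, s, .inl rfl⟩)))) Tm.var)
    simp only [Tm.subst, truthConst_subst] at this
    exact this
  imp_const r s := by
    have := hT _ (.ax (.inr (.inl (.inr (Set.mem_iUnion₂.mpr ⟨r, s, .inr rfl⟩)))) Tm.var)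
    simp only [Tm.subst, truthConst_subst] at this
    exact this

/-- The truth value modulo a prime theory, as an element of the unit interval, is a valuation. -/
theorem IsTheory.exists_valuation (h : IsAdmissibleExpansion Ax E)
    {I : Interp σ unitInterval} (hI : InVariety E I) (hT : IsTheory (pavelkaAx Ax J) T)
    (hP : IsPrimePavelkaFilter T (truthConst (σ := σ))) :
    ∃ e : ℕ → unitInterval, ∀ a : Fm σ.pavelka,
      ((a.eval I.pavelka e : unitInterval) : ℝ) =
        IsPrimePavelkaFilter.value T truthConst a := by
  let g : Fm σ.pavelka → unitInterval := fun a =>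
    ⟨IsPrimePavelkaFilter.value T truthConst a, hP.value_nonneg a, hP.value_le_one a⟩
  have gzero : g .zero = MVOps.zero := Subtype.ext hP.value_zero
  have gimp : ∀ a b, g (.imp a b) = MVOps.imp (g a) (g b) := fun a b =>
    Subtype.ext (hP.value_imp a b)
  have gconst : ∀ r, g (truthConst r) = r := fun r => Subtype.ext (hP.value_const r)
  have gker : ∀ a b, hT.isImpFilter.setoid a b → g a = g b := fun a b hab =>
    Subtype.ext (le_antisymm (hP.value_mono hab.1) (hP.value_mono hab.2))
  obtain ⟨B, hB⟩ : ∃ B : MVSub unitInterval, B.carrier = Set.range g :=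
    ⟨{ carrier := Set.range g
       zero_mem := ⟨_, gzero⟩
       imp_mem := by
        rintro _ ⟨a, rfl⟩ _ ⟨b, rfl⟩
        exact ⟨_, gimp a b⟩ }, rfl⟩
  let gB : Fm σ.pavelka → B.carrier := fun a => ⟨g a, hB ▸ Set.mem_range_self a⟩
  have hsurj : Function.Surjective gB := by
    rintro ⟨x, hx⟩
    obtain ⟨a, rfl⟩ := hB ▸ hx
    exact ⟨a, rfl⟩
  have gBimp : ∀ a b, gB (.imp a b) = MVOps.imp (gB a) (gB b) := fun a b =>
    Subtype.ext (gimp a b)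
  have gBker : ∀ a b, hT.isImpFilter.setoid a b → gB a = gB b := fun a b hab =>
    Subtype.ext (gker a b hab)
  let IB : Interp σ B.carrier := fun f x =>
    gB (.op (σ := σ.pavelka) (Sum.inl f) fun i => (hsurj (x i)).choose)
  have gBop : ∀ (f : σ.Op) (x : Fin (σ.ar f) → Fm σ.pavelka),
      gB (.op (σ := σ.pavelka) (Sum.inl f) x) = IB f fun i => gB (x i) := fun f x =>
    hT.map_op_eq h gBimp gBker f fun i => (hsurj (gB (x i))).choose_spec.symm
  have hIB : InVariety E IB :=
    hT.inVariety_of_surjective h hsurj (Subtype.ext gzero) gBimp gBop gBker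
  have hdense : Dense B.carrier := dense_of_forall_mem fun r => hB ▸ ⟨_, gconst r⟩
  refine ⟨fun n => g (.var n), fun a => ?_⟩
  suffices H : a.eval I.pavelka (fun n => g (.var n)) = g a from congrArg Subtype.val H
  induction a with
  | var n => rfl
  | zero => exact gzero.symm
  | imp a b iha ihb => rw [Tm.eval, iha, ihb, gimp]
  | op f args ih =>
    rw [Tm.eval, funext ih]
    rcases f with f | r
    · have := congrArg Subtype.val (gBop f args)
      rw [h.admissible.coe_interp_eq hIB hdense hI] at this
      exact this.symm
    · rw [op_inr_eq_truthConst, gconst]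
      rfl

/-- If `r → φ` is not in a theory, then some model of the theory gives `φ` a value at most `r`. -/
theorem IsTheory.exists_model (h : IsAdmissibleExpansion Ax E)
    {I : Interp σ unitInterval} (hI : InVariety E I) (hT : IsTheory (pavelkaAx Ax J) T)
    {r : RatI} {φ : Fm σ.pavelka} (hr : Tm.imp (truthConst r) φ ∉ T) :
    ∃ e : ℕ → unitInterval, (∀ b ∈ T, b.eval I.pavelka e = 1) ∧
      φ.eval I.pavelka e ≤ (r : unitInterval) := by
  obtain ⟨F, hTF, hF, hrF, hprime⟩ :=
    hT.isImpFilter.exists_prime (hT.prelinearity_mem h) hr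
  have hFT := hT.of_isImpFilter hTF hF
  have hP := hFT.isPrimePavelkaFilter hrF hprime
  obtain ⟨e, he⟩ := hFT.exists_valuation h hI hP
  refine ⟨e, fun b hb => Subtype.ext ((he b).trans (hP.value_eq_one (hTF hb))), ?_⟩
  exact (he φ).trans_le (hP.value_le ((hprime φ (truthConst r)).resolve_right hrF))

end Valuation

end Pavelka

theorem theorem2p8 {σ : Signature.{u}} (Ax : Set (Fm σ)) (E : Set (Fm σ × Fm σ))
    (h : IsAdmissibleExpansion Ax E)
    (I : Interp σ unitInterval) (hI : InVariety E I)
    (J : Interp σ RatI) (hJ : InVariety E J)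
    (T : Set (Fm σ.pavelka)) (hT : IsTheory (pavelkaAx Ax J) T) (φ : Fm σ.pavelka) :
    proofDegree T φ = truthDegree I T φ := by
  apply le_antisymm
  · refine sSup_le ?_
    rintro _ ⟨r, rfl, hr⟩
    refine le_sInf ?_
    rintro _ ⟨e, he, rfl⟩
    have h1 := congrArg Subtype.val (he _ hr)
    rw [Tm.eval, eval_truthConst, coe_imp] at h1
    have h2 : (1 : ℝ) ≤ 1 - ((r : unitInterval) : ℝ) + (φ.eval I.pavelka e : unitInterval) :=
      min_eq_left_iff.mp h1
    exact Subtype.coe_le_coe.mp (by linarith)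
  -- A rational strictly between the two degrees contradicts the existence of countermodels.
  · by_contra hlt
    rw [not_le] at hlt
    obtain ⟨r, h₁, h₂⟩ := RatI.exists_btwn (proofDegree T φ).2.1 (truthDegree I T φ).2.2 hlt
    have hr : Tm.imp (truthConst r) φ ∉ T := fun hr =>
      absurd (le_sSup ⟨r, rfl, hr⟩ : (r : unitInterval) ≤ proofDegree T φ) (not_le.mpr h₁)
    obtain ⟨e, he, hle⟩ := hT.exists_model h hI hr
    exact absurd ((sInf_le ⟨e, he, rfl⟩ : truthDegree I T φ ≤ _).trans hle) (not_le.mpr h₂)
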